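/- Let $\mathbb{D}$ be the open unit disc and let $\lambda$ be the normalized Lebesgue measure on the unit circle $\partial\mathbb{D}$. Let $f\colon \mathbb{D}\to\mathbb{D}$ be an inner function, that is, a holomorphic map such that for $\lambda$-almost every $\xi\in\partial\mathbb{D}$ the radial limit $f(\xi):=\lim_{r\to1^-} f(r\xi)$ exists and has modulus $1$. Let $p\in\partial\mathbb{D}$ be a boundary Fatou point of $f$, that is, $f(p)=\lim_{r\to 1^-}f(rp)$ exists and $f(p)\in\partial\mathbb{D}$. For $\beta>1$ let $\Gamma_\beta(p)=\{z\in\mathbb{D}: |z-p|<\beta(1-|z|)\}$. If for some $\eta\in\partial\mathbb{D}$ and some $\beta>1$ the limit $f'(p):=\lim_{\Gamma_\beta(p)\ni z\to p}\frac{\eta-f(z)}{p-z}$ exists and is finite, then $f$ is said to have the finite angular derivative $f'(p)$ at $p$; otherwise put $|f'(p)|=\infty$. For $a\in\partial\mathbb{D}$ and measurable $A\subseteq\partial\mathbb{D}$ let $\mu_a(A)=\int_A |\xi-a|^{-2}\,d\lambda(\xi)\in[0,\infty]$, and for $E\subseteq\partial\mathbb{D}$ let $f^{-1}(E)$ be the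 set of all $\xi\in\partial\mathbb{D}$ at which the radial limit $f(\xi)$ exists and belongs to $E$. Then, for every (Lebesgue) measurable set $E\subseteq\partial\mathbb{D}$, the set $f^{-1}(E)$ is measurable, and: (a) if $|f'(p)|<\infty$, then $\mu_p(f^{-1}(E))=|f'(p)|\,\mu_{f(p)}(E)$; (b) if $|f'(p)|=\infty$, then $\mu_p(f^{-1}(E))=\infty$ whenever $\mu_{f(p)}(E)>0$, and $\mu_p(f^{-1}(E))=0$ whenever $\mu_{f(p)}(E)=0$. -/

import Mathlib

open Filter Topology MeasureTheory Metric
open scoped ENNReal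

noncomputable section

namespace InnerFun

/-- `w` is the radial limit of `f` at `ξ`, that is `f (r ξ) → w` as `r → 1⁻`. -/
def HasRadialLimit (f : ℂ → ℂ) (ξ w : ℂ) : Prop :=
  Tendsto (fun r : ℝ => f ((r : ℂ) * ξ)) (𝓝[<] (1 : ℝ)) (𝓝 w)

/-- Normalized Lebesgue (arc length) measure on the unit circle, regarded as a Borel measure
on `ℂ` carried by the unit circle. -/
def lebCircle : Measure ℂ :=
  (ENNReal.ofReal (2 * Real.pi))⁻¹ •
    (volume.restrict (Set.Ioc 0 (2 * Real.pi))).map (circleMap 0 1)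

/-- An inner function: a holomorphic self map of the open unit disc (the values of `f` outside
the disc are irrelevant) having a unimodular radial limit at almost every point of the circle. -/
structure IsInner (f : ℂ → ℂ) : Prop where
  differentiableOn : DifferentiableOn ℂ f (ball 0 1)
  mapsTo : Set.MapsTo f (ball 0 1) (ball 0 1)
  radial : ∀ᵐ ξ ∂lebCircle, ∃ w ∈ sphere (0 : ℂ) 1, HasRadialLimit f ξ w

/-- The preimage of `E` under the boundary map `ξ ↦ lim_{r → 1} f (r ξ)`, which is defined at
those points of the circle where this limit exists. -/
def boundaryPreimage (f : ℂ → ℂ) (E : Set ℂ) : Set ℂ :=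
  {ξ | ξ ∈ sphere (0 : ℂ) 1 ∧ ∃ w ∈ E, HasRadialLimit f ξ w}

/-- The Stolz angle with vertex `p` and opening `β`; it is nonempty exactly when `1 < β`
(for `p` on the unit circle). -/
def stolzAngle (β : ℝ) (p : ℂ) : Set ℂ :=
  {z | z ∈ ball (0 : ℂ) 1 ∧ ‖z - p‖ < β * (1 - ‖z‖)}

/-- `d` is the (finite) angular derivative of `f` at the boundary point `p`. -/
def HasAngularDeriv (f : ℂ → ℂ) (p d : ℂ) : Prop :=
  ∃ η ∈ sphere (0 : ℂ) 1, ∃ β : ℝ, 1 < β ∧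
    Tendsto (fun z => (η - f z) / (p - z)) (𝓝[stolzAngle β p] p) (𝓝 d)

open Classical in
/-- The modulus `|f'(p)|` of the angular derivative, equal to `∞` if there is no finite angular
derivative at `p`. -/
def absAngularDeriv (f : ℂ → ℂ) (p : ℂ) : ℝ≥0∞ :=
  if h : ∃ d, HasAngularDeriv f p d then ‖h.choose‖ₑ else ∞

/-- The measure `μ_p(E) = ∫_E |ξ - p|⁻² dλ(ξ)`. -/
def muMeasure (p : ℂ) : Measure ℂ :=
  lebCircle.withDensity fun ξ => (‖ξ - p‖ₑ ^ 2)⁻¹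

end InnerFun

end

open scoped ComplexConjugate

namespace InnerFun

/-! Write `harmonicMeasure z` as (1 - |z|²) μ_z. Löwner's lemma (`IsInner.map_harmonicMeasure`) says
that the boundary map pushes it forward to `harmonicMeasure (f z)`. Taking z = rp and dividing by 1
- r² gives μ_{rp}(f⁻¹E) = (1 - |f(rp)|²)/(1 - r²) · μ_{f(rp)}(E), and the theorem is the limit of
this identity as r → 1.

The left side tends to μ_p(f⁻¹E), because rp → p nontangentially (`tendsto_muMeasure`). The right
side is governed by Julia–Carathéodory (`exists_tendsto_sub_div_sub`), which produces c ≥ 0 with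
|f'(p)| = 1/c. If c > 0, the quotient tends to 1/c and f(rp) → f(p) nontangentially, so the last
factor converges too. If c = 0, Julia's lemma forces the quotient to infinity; f(rp) may now
approach f(p) tangentially, but lower semicontinuity of ζ ↦ μ_ζ(E) suffices. The null-set statement
is Löwner's lemma at z = 0.

Löwner's lemma itself holds because both measures have n-th moment f(z)ⁿ, by the Poisson formula,
and moments determine a finite measure on the circle. -/

/-! ### Schwarz–Pick and Julia–Carathéodory. -/

lemma sq_norm_add_conj (a b : ℂ) : ‖a + conj b‖ ^ 2 = ‖a - b‖ ^ 2 + 4 * a.re * b.re := by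
  simp only [Complex.sq_norm, Complex.normSq_apply, Complex.add_re, Complex.add_im,
    Complex.sub_re, Complex.sub_im, Complex.conj_re, Complex.conj_im]
  ring

lemma sq_norm_one_sub_conj_mul (w z : ℂ) :
    ‖1 - conj w * z‖ ^ 2 = ‖z - w‖ ^ 2 + (1 - ‖z‖ ^ 2) * (1 - ‖w‖ ^ 2) := by
  simp only [Complex.sq_norm, Complex.normSq_apply, Complex.mul_re, Complex.mul_im,
    Complex.sub_re, Complex.sub_im, Complex.conj_re, Complex.conj_im, Complex.one_re,
    Complex.one_im]
  ring

lemma one_sub_sq_norm_pos {z : ℂ} (hz : z ∈ ball (0 : ℂ) 1) : 0 < 1 - ‖z‖ ^ 2 := by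
  have h : ‖z‖ < 1 := by simpa using hz
  nlinarith [norm_nonneg z]

lemma one_sub_conj_mul_ne_zero {w z : ℂ} (hw : w ∈ ball (0 : ℂ) 1) (hz : z ∈ ball (0 : ℂ) 1) :
    1 - conj w * z ≠ 0 := by
  intro h
  have h1 := sq_norm_one_sub_conj_mul w z
  rw [h] at h1
  have := mul_pos (one_sub_sq_norm_pos hz) (one_sub_sq_norm_pos hw)
  simp only [norm_zero] at h1
  nlinarith [sq_nonneg ‖z - w‖]

/-- The disc automorphism sending `0` to `w` preserves the disc. -/
lemma mobius_mem_ball {w u : ℂ} (hw : w ∈ ball (0 : ℂ) 1) (hu : u ∈ ball (0 : ℂ) 1) :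
    (u + w) / (1 + conj w * u) ∈ ball (0 : ℂ) 1 := by
  have hw' : -w ∈ ball (0 : ℂ) 1 := by simpa using hw
  have hne := one_sub_conj_mul_ne_zero hw' hu
  have h := sq_norm_one_sub_conj_mul (-w) u
  have hpos := mul_pos (one_sub_sq_norm_pos hu) (one_sub_sq_norm_pos hw')
  simp only [map_neg, neg_mul, sub_neg_eq_add] at h hne
  rw [mem_ball_zero_iff, norm_div, div_lt_one (norm_pos_iff.2 hne)]
  exact lt_of_pow_lt_pow_left₀ 2 (norm_nonneg _) (by linarith)

/-- **Schwarz–Pick inequality** for maps from the disc to the open right half plane. -/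
lemma schwarz_pick_of_re_pos {K : ℂ → ℂ} (hK : DifferentiableOn ℂ K (ball 0 1))
    (hpos : ∀ z ∈ ball (0 : ℂ) 1, 0 < (K z).re) {z w : ℂ} (hz : z ∈ ball (0 : ℂ) 1)
    (hw : w ∈ ball (0 : ℂ) 1) :
    ‖K z - K w‖ ^ 2 * ((1 - ‖z‖ ^ 2) * (1 - ‖w‖ ^ 2)) ≤
      ‖z - w‖ ^ 2 * (4 * (K z).re * (K w).re) := by
  have hden : ∀ u ∈ ball (0 : ℂ) 1, K u + conj (K w) ≠ 0 := by
    intro u hu h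
    have h1 := congrArg Complex.re h
    simp only [Complex.add_re, Complex.conj_re, Complex.zero_re] at h1
    linarith [hpos u hu, hpos w hw]
  let m : ℂ → ℂ := fun u => (u + w) / (1 + conj w * u)
  have hw' : -w ∈ ball (0 : ℂ) 1 := by simpa using hw
  have hmne : ∀ u ∈ ball (0 : ℂ) 1, 1 + conj w * u ≠ 0 := fun u hu => by
    simpa using one_sub_conj_mul_ne_zero hw' hu
  have hm : Set.MapsTo m (ball 0 1) (ball 0 1) := fun u hu => mobius_mem_ball hw hu
  have hmd : DifferentiableOn ℂ m (ball 0 1) := by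
    apply DifferentiableOn.div (by fun_prop) (by fun_prop) hmne
  -- A half-plane Cayley transform centred at `K w`, after the automorphism `m` with `m 0 = w`: the
  -- Schwarz lemma at the origin applies.
  let φ : ℂ → ℂ := fun u => (K (m u) - K w) / (K (m u) + conj (K w))
  have hKm : DifferentiableOn ℂ (fun u => K (m u)) (ball 0 1) := hK.comp hmd hm
  have hφd : DifferentiableOn ℂ φ (ball 0 1) :=
    (hKm.sub_const _).div (hKm.add_const _) fun u hu => hden _ (hm hu)
  have hφm : Set.MapsTo φ (ball 0 1) (closedBall 0 1) := by
    intro u hu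
    have hne := hden _ (hm hu)
    rw [mem_closedBall_zero_iff, norm_div, div_le_one (norm_pos_iff.2 hne)]
    refine le_of_sq_le_sq ?_ (norm_nonneg _)
    rw [sq_norm_add_conj]
    nlinarith [mul_pos (hpos _ (hm hu)) (hpos w hw)]
  have hm0 : m 0 = w := by simp [m]
  have hφ0 : φ 0 = 0 := by simp [φ, hm0]
  have hzw := one_sub_conj_mul_ne_zero hw hz
  set u₀ : ℂ := (z - w) / (1 - conj w * z) with hu₀
  have hu₀n : ‖u₀‖ < 1 := by
    have h := sq_norm_one_sub_conj_mul w z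
    have hpos := mul_pos (one_sub_sq_norm_pos hz) (one_sub_sq_norm_pos hw)
    rw [hu₀, norm_div, div_lt_one (norm_pos_iff.2 hzw)]
    exact lt_of_pow_lt_pow_left₀ 2 (norm_nonneg _) (by linarith)
  have hmu : m u₀ = z := by
    have h1 : 1 + conj w * u₀ ≠ 0 := hmne _ (by simpa using hu₀n)
    have h2 : u₀ * (1 - conj w * z) = z - w := div_mul_cancel₀ _ hzw
    simp only [m]
    rw [div_eq_iff h1]
    linear_combination h2
  have key := Complex.norm_le_norm_of_mapsTo_ball hφd hφm hφ0 hu₀n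
  have hzd := hden z hz
  simp only [φ, hmu] at key
  rw [hu₀, norm_div, norm_div, div_le_div_iff₀ (norm_pos_iff.2 hzd) (norm_pos_iff.2 hzw)] at key
  -- After squaring and expanding both denominators, the term |z - w|² |K z - K w|² cancels.
  have key2 := pow_le_pow_left₀ (by positivity) key 2
  rw [mul_pow, mul_pow, sq_norm_add_conj, sq_norm_one_sub_conj_mul] at key2
  linarith

/-- **Schwarz–Pick inequality** for maps from the disc to the closed right half plane. -/
lemma schwarz_pick_of_re_nonneg {K : ℂ → ℂ} (hK : DifferentiableOn ℂ K (ball 0 1))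
    (hnn : ∀ z ∈ ball (0 : ℂ) 1, 0 ≤ (K z).re) {z w : ℂ} (hz : z ∈ ball (0 : ℂ) 1)
    (hw : w ∈ ball (0 : ℂ) 1) :
    ‖K z - K w‖ ^ 2 * ((1 - ‖z‖ ^ 2) * (1 - ‖w‖ ^ 2)) ≤
      ‖z - w‖ ^ 2 * (4 * (K z).re * (K w).re) := by
  have hlim : Tendsto (fun δ : ℝ => ‖z - w‖ ^ 2 * (4 * ((K z).re + δ) * ((K w).re + δ)))
      (𝓝[>] 0) (𝓝 (‖z - w‖ ^ 2 * (4 * (K z).re * (K w).re))) := by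
    have : Continuous (fun δ : ℝ => ‖z - w‖ ^ 2 * (4 * ((K z).re + δ) * ((K w).re + δ))) := by
      fun_prop
    simpa using (this.tendsto 0).mono_left nhdsWithin_le_nhds
  refine ge_of_tendsto hlim ?_
  filter_upwards [self_mem_nhdsWithin] with δ (hδ : 0 < δ)
  have := schwarz_pick_of_re_pos (K := fun z => K z + (δ : ℂ)) (hK.add_const _)
    (fun z hz => by simpa using add_pos_of_nonneg_of_pos (hnn z hz) hδ) hz hw
  simpa using this

lemma re_add_div_sub (a b : ℂ) :
    ((a + b) / (a - b)).re = (‖a‖ ^ 2 - ‖b‖ ^ 2) / ‖a - b‖ ^ 2 := by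
  have h := congrFun (poissonKernel_eq_re_herglotzRieszKernel (c := 0) (w := b)) a
  simpa [poissonKernel_def, herglotzRieszKernel_def] using h.symm

lemma sub_ne_zero_of_sphere {q w : ℂ} (hq : q ∈ sphere (0 : ℂ) 1) (hw : w ∈ ball (0 : ℂ) 1) :
    q - w ≠ 0 := by
  intro h
  rw [← sub_eq_zero.1 h, mem_ball] at hw
  exact hw.ne hq

/-- A holomorphic function with nonnegative real part on the disc whose real part is not bounded
below by a positive multiple of the Poisson kernel at `p` is `o(1 / |p - z|)` in Stolz angles. -/
lemma tendsto_mul_sub_zero_of_re_nonneg {L : ℂ → ℂ} (hL : DifferentiableOn ℂ L (ball 0 1))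
    (hnn : ∀ z ∈ ball (0 : ℂ) 1, 0 ≤ (L z).re) {p : ℂ}
    (hinf : ∀ ε > 0, ∃ w ∈ ball (0 : ℂ) 1, (L w).re * ‖p - w‖ ^ 2 < ε * (1 - ‖w‖ ^ 2))
    (β : ℝ) : Tendsto (fun z => L z * (p - z)) (𝓝[stolzAngle β p] p) (𝓝 0) := by
  rw [Metric.tendsto_nhds]
  intro δ hδ
  set B : ℝ := |β| + 1 with hB
  have hBpos : 0 < B := by positivity
  -- The base point `w` stays fixed while z → p; its strict inequality at p persists nearby by
  -- continuity. The constant 32B yields the factor δ/8 in `k2`.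
  obtain ⟨w, hw, hwε⟩ := hinf (δ / (32 * B)) (by positivity)
  have hw1 := one_sub_sq_norm_pos hw
  have e1 : ∀ᶠ z in 𝓝[stolzAngle β p] p,
      (L w).re * ‖z - w‖ ^ 2 < δ / (32 * B) * (1 - ‖w‖ ^ 2) := by
    have hc : ContinuousAt (fun z => (L w).re * ‖z - w‖ ^ 2) p := by fun_prop
    exact nhdsWithin_le_nhds (hc.eventually_lt continuousAt_const hwε)
  have e2 : ∀ᶠ z in 𝓝[stolzAngle β p] p, ‖L w‖ * ‖p - z‖ < δ / 4 := by
    have hc : ContinuousAt (fun z => ‖L w‖ * ‖p - z‖) p := by fun_prop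
    exact nhdsWithin_le_nhds (hc.eventually_lt continuousAt_const (by simpa using hδ))
  filter_upwards [e1, e2, self_mem_nhdsWithin] with z h1 h2 hz
  obtain ⟨hzb, hzs⟩ := hz
  have hz1 := one_sub_sq_norm_pos hzb
  have hzn : ‖z‖ < 1 := by simpa using hzb
  have hpz : ‖p - z‖ ≤ B * (1 - ‖z‖ ^ 2) := by
    rw [norm_sub_rev]
    have hβ : β ≤ B := (le_abs_self β).trans (by linarith)
    have : β * (1 - ‖z‖) ≤ B * (1 - ‖z‖) := by gcongr
    have h3 : 1 - ‖z‖ ≤ 1 - ‖z‖ ^ 2 := by nlinarith [norm_nonneg z]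
    have h4 : B * (1 - ‖z‖) ≤ B * (1 - ‖z‖ ^ 2) := by gcongr
    linarith
  have key := schwarz_pick_of_re_nonneg hL hnn hzb hw
  set t := ‖L z - L w‖ with ht
  set s := ‖p - z‖ with hs
  have ht0 : 0 ≤ t := norm_nonneg _
  have hs0 : 0 ≤ s := norm_nonneg _
  have hLz : (L z).re ≤ t + ‖L w‖ := by
    refine (Complex.re_le_norm _).trans ?_
    calc ‖L z‖ = ‖(L z - L w) + L w‖ := by ring_nf
      _ ≤ _ := norm_add_le _ _
  have hLz0 := hnn z hzb
  have k1 : t ^ 2 * (1 - ‖z‖ ^ 2) ≤ 4 * (L z).re * (δ / (32 * B)) := by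
    have : t ^ 2 * (1 - ‖z‖ ^ 2) * (1 - ‖w‖ ^ 2) ≤
        4 * (L z).re * (δ / (32 * B)) * (1 - ‖w‖ ^ 2) := by
      have := mul_le_mul_of_nonneg_left h1.le (by positivity : 0 ≤ 4 * (L z).re)
      nlinarith
    exact le_of_mul_le_mul_right this hw1
  have k2 : t ^ 2 * s ≤ (L z).re * (δ / 8) := by
    have h5 : t ^ 2 * s ≤ B * (t ^ 2 * (1 - ‖z‖ ^ 2)) := by
      nlinarith [mul_le_mul_of_nonneg_left hpz (sq_nonneg t)]
    have h6 : B * (t ^ 2 * (1 - ‖z‖ ^ 2)) ≤ B * (4 * (L z).re * (δ / (32 * B))) := by gcongr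
    have h7 : B * (4 * (L z).re * (δ / (32 * B))) = (L z).re * (δ / 8) := by
      field_simp
      ring
    linarith
  have k3 : (t * s) ^ 2 ≤ (t * s + δ / 4) * (δ / 8) := by
    have h8 : t ^ 2 * s * s ≤ (L z).re * (δ / 8) * s := by gcongr
    have h9 : (L z).re * (δ / 8) * s ≤ (t + ‖L w‖) * (δ / 8) * s := by gcongr
    have h10 : ‖L w‖ * s * (δ / 8) ≤ δ / 4 * (δ / 8) := by gcongr
    nlinarith
  -- The quadratic inequality `k3` for x = ts fails once x ≥ δ/2.
  have k4 : t * s < δ / 2 := by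
    by_contra! h
    nlinarith [mul_nonneg ht0 hs0]
  rw [dist_zero_right, norm_mul]
  have hn : ‖L z‖ ≤ t + ‖L w‖ := by
    calc ‖L z‖ = ‖(L z - L w) + L w‖ := by ring_nf
      _ ≤ _ := norm_add_le _ _
  calc ‖L z‖ * s ≤ (t + ‖L w‖) * s := by gcongr
    _ = t * s + ‖L w‖ * s := by ring
    _ < δ := by linarith

/-- **Julia–Carathéodory theorem** for holomorphic functions with nonnegative real part. -/
lemma exists_tendsto_mul_sub_of_re_nonneg {K : ℂ → ℂ} (hK : DifferentiableOn ℂ K (ball 0 1))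
    (hnn : ∀ z ∈ ball (0 : ℂ) 1, 0 ≤ (K z).re) {p : ℂ} (hp : p ∈ sphere (0 : ℂ) 1) :
    ∃ c : ℝ, 0 ≤ c ∧
      (∀ b : ℝ, (∀ z ∈ ball (0 : ℂ) 1, b * (1 - ‖z‖ ^ 2) ≤ (K z).re * ‖p - z‖ ^ 2) → b ≤ c) ∧
      ∀ β : ℝ, Tendsto (fun z => K z * (p - z)) (𝓝[stolzAngle β p] p) (𝓝 (2 * c * p)) := by
  -- Quotients of Re K by the Poisson kernel at p: inf S is the largest multiple of that kernel
  -- lying below Re K. Subtracting this multiple leaves a function `L` with no such minorant, hence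
  -- negligible at p.
  let S : Set ℝ := (fun z => (K z).re * ‖p - z‖ ^ 2 / (1 - ‖z‖ ^ 2)) '' ball (0 : ℂ) 1
  have hS0 : ∀ x ∈ S, 0 ≤ x := by
    rintro _ ⟨z, hz, rfl⟩
    have := one_sub_sq_norm_pos hz
    have := hnn z hz
    positivity
  have hSne : S.Nonempty := ⟨_, 0, by simp, rfl⟩
  have hSb : BddBelow S := ⟨0, hS0⟩
  have hc : ∀ z ∈ ball (0 : ℂ) 1, sInf S ≤ (K z).re * ‖p - z‖ ^ 2 / (1 - ‖z‖ ^ 2) :=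
    fun z hz => csInf_le hSb ⟨z, hz, rfl⟩
  have hp1 : ‖p‖ = 1 := by simpa using hp
  refine ⟨sInf S, le_csInf hSne hS0, fun b hb => le_csInf hSne ?_, fun β => ?_⟩
  · rintro _ ⟨z, hz, rfl⟩
    rw [le_div_iff₀ (one_sub_sq_norm_pos hz)]
    exact hb z hz
  set c := sInf S
  let L : ℂ → ℂ := fun z => K z - c * ((p + z) / (p - z))
  have hre : ∀ z ∈ ball (0 : ℂ) 1,
      (L z).re * ‖p - z‖ ^ 2 = (K z).re * ‖p - z‖ ^ 2 - c * (1 - ‖z‖ ^ 2) := by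
    intro z hz
    have hne : ‖p - z‖ ≠ 0 := norm_ne_zero_iff.2 (sub_ne_zero_of_sphere hp hz)
    simp only [L, Complex.sub_re, Complex.re_ofReal_mul, re_add_div_sub, hp1]
    field_simp
  have hLd : DifferentiableOn ℂ L (ball 0 1) := by
    refine hK.sub (DifferentiableOn.const_mul (DifferentiableOn.div (by fun_prop) (by fun_prop)
      fun z hz => sub_ne_zero_of_sphere hp hz) _)
  have hLnn : ∀ z ∈ ball (0 : ℂ) 1, 0 ≤ (L z).re := by
    intro z hz
    have hne : 0 < ‖p - z‖ := norm_pos_iff.2 (sub_ne_zero_of_sphere hp hz)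
    have h1 := hc z hz
    rw [le_div_iff₀ (one_sub_sq_norm_pos hz)] at h1
    have h2 := hre z hz
    by_contra! h
    nlinarith [mul_pos (neg_pos.2 h) (pow_pos hne 2)]
  have hinf : ∀ ε > 0, ∃ w ∈ ball (0 : ℂ) 1, (L w).re * ‖p - w‖ ^ 2 < ε * (1 - ‖w‖ ^ 2) := by
    intro ε hε
    obtain ⟨_, ⟨w, hw, rfl⟩, hlt⟩ := exists_lt_of_csInf_lt hSne (lt_add_of_pos_right c hε)
    refine ⟨w, hw, ?_⟩
    rw [div_lt_iff₀ (one_sub_sq_norm_pos hw)] at hlt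
    rw [hre w hw]
    linarith
  have h0 := tendsto_mul_sub_zero_of_re_nonneg hLd hLnn hinf β
  have h1 : Tendsto (fun z => (c : ℂ) * (p + z)) (𝓝[stolzAngle β p] p) (𝓝 (c * (p + p))) :=
    ((by fun_prop : Continuous fun z => (c : ℂ) * (p + z)).tendsto p).mono_left
      nhdsWithin_le_nhds
  have h2 := h0.add h1
  rw [show (0 : ℂ) + c * (p + p) = 2 * c * p by ring] at h2
  refine h2.congr' ?_
  filter_upwards [self_mem_nhdsWithin] with z hz
  have hne := sub_ne_zero_of_sphere hp hz.1
  simp only [L]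
  field_simp
  ring

/-- **Julia–Carathéodory theorem** for self maps of the disc. The number `c` is the reciprocal of
the modulus of the angular derivative. -/
lemma exists_tendsto_sub_div_sub {f : ℂ → ℂ} (hf : DifferentiableOn ℂ f (ball 0 1))
    (hm : Set.MapsTo f (ball 0 1) (ball 0 1)) {p q : ℂ} (hp : p ∈ sphere (0 : ℂ) 1)
    (hq : q ∈ sphere (0 : ℂ) 1) :
    ∃ c : ℝ, 0 ≤ c ∧
      (∀ b : ℝ, (∀ z ∈ ball (0 : ℂ) 1,
        b * (1 - ‖z‖ ^ 2) * ‖q - f z‖ ^ 2 ≤ (1 - ‖f z‖ ^ 2) * ‖p - z‖ ^ 2) → b ≤ c) ∧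
      ∀ β : ℝ, Tendsto (fun z => (p - z) / (q - f z)) (𝓝[stolzAngle β p] p)
        (𝓝 (c * p / q)) := by
  have hq1 : ‖q‖ = 1 := by simpa using hq
  have hq0 : q ≠ 0 := norm_ne_zero_iff.1 (by rw [hq1]; exact one_ne_zero)
  have hne : ∀ z ∈ ball (0 : ℂ) 1, q - f z ≠ 0 := fun z hz => sub_ne_zero_of_sphere hq (hm hz)
  obtain ⟨c, hc0, hc, hlim⟩ := exists_tendsto_mul_sub_of_re_nonneg
    (K := fun z => (q + f z) / (q - f z)) ((hf.const_add q).div (hf.const_sub q) hne)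
    (fun z hz => by
      rw [re_add_div_sub, hq1, one_pow]
      exact div_nonneg (one_sub_sq_norm_pos (hm hz)).le (by positivity)) hp
  refine ⟨c, hc0, fun b hb => hc b fun z hz => ?_, fun β => ?_⟩
  · rw [re_add_div_sub, hq1, one_pow, div_mul_eq_mul_div,
      le_div_iff₀ (pow_pos (norm_pos_iff.2 (hne z hz)) 2)]
    exact hb z hz
  · have h1 : Tendsto (fun z => p - z) (𝓝[stolzAngle β p] p) (𝓝 (p - p)) :=
      ((by fun_prop : Continuous fun z : ℂ => p - z).tendsto p).mono_left nhdsWithin_le_nhds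
    -- With K = (q + f)/(q - f) one has K + 1 = 2q/(q - f).
    have h2 := ((hlim β).add h1).div_const (2 * q)
    rw [show (2 * c * p + (p - p)) / (2 * q) = c * p / q by field_simp; ring] at h2
    refine h2.congr' ?_
    filter_upwards [self_mem_nhdsWithin] with z hz
    have := hne z hz.1
    field_simp
    ring

/-- **Schwarz–Pick inequality** for self maps of the disc. -/
lemma schwarz_pick_of_mapsTo_ball {f : ℂ → ℂ} (hf : DifferentiableOn ℂ f (ball 0 1))
    (hm : Set.MapsTo f (ball 0 1) (ball 0 1)) {z w : ℂ} (hz : z ∈ ball (0 : ℂ) 1)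
    (hw : w ∈ ball (0 : ℂ) 1) :
    ‖f z - f w‖ ^ 2 * ((1 - ‖z‖ ^ 2) * (1 - ‖w‖ ^ 2)) ≤
      ‖z - w‖ ^ 2 * ((1 - ‖f z‖ ^ 2) * (1 - ‖f w‖ ^ 2)) := by
  have hq : (1 : ℂ) ∈ sphere (0 : ℂ) 1 := by simp
  have hne : ∀ z ∈ ball (0 : ℂ) 1, 1 - f z ≠ 0 := fun z hz => sub_ne_zero_of_sphere hq (hm hz)
  have key := schwarz_pick_of_re_nonneg
    (K := fun z => (1 + f z) / (1 - f z)) ((hf.const_add 1).div (hf.const_sub 1) hne)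
    (fun z hz => by
      rw [re_add_div_sub, norm_one, one_pow]
      exact div_nonneg (one_sub_sq_norm_pos (hm hz)).le (by positivity)) hz hw
  have hz0 := hne z hz
  have hw0 := hne w hw
  have hz1 : 0 < ‖1 - f z‖ := norm_pos_iff.2 hz0
  have hw1 : 0 < ‖1 - f w‖ := norm_pos_iff.2 hw0
  have hd : (1 + f z) / (1 - f z) - (1 + f w) / (1 - f w) =
      2 * (f z - f w) / ((1 - f z) * (1 - f w)) := by
    field_simp
    ring
  simp only [re_add_div_sub, hd, norm_one, one_pow, norm_div, norm_mul, Complex.norm_ofNat] at key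
  have h4 : ‖f z - f w‖ ^ 2 * ((1 - ‖z‖ ^ 2) * (1 - ‖w‖ ^ 2)) =
      (2 * ‖f z - f w‖ / (‖1 - f z‖ * ‖1 - f w‖)) ^ 2 * ((1 - ‖z‖ ^ 2) * (1 - ‖w‖ ^ 2)) *
        ((‖1 - f z‖ * ‖1 - f w‖) ^ 2 / 4) := by
    field_simp
    ring
  have h5 : ‖z - w‖ ^ 2 * ((1 - ‖f z‖ ^ 2) * (1 - ‖f w‖ ^ 2)) =
      ‖z - w‖ ^ 2 * (4 * ((1 - ‖f z‖ ^ 2) / ‖1 - f z‖ ^ 2) * ((1 - ‖f w‖ ^ 2) / ‖1 - f w‖ ^ 2)) *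
        ((‖1 - f z‖ * ‖1 - f w‖) ^ 2 / 4) := by
    field_simp
  rw [h4, h5]
  gcongr

/-! ### Moments of measures on the circle. -/

/-- A finite Borel measure on `ℂ` carried by the unit circle is determined by its moments. -/
lemma measure_ext_of_moments {μ ν : Measure ℂ} [IsFiniteMeasure μ] [IsFiniteMeasure ν]
    (hμ : ∀ᵐ x ∂μ, x ∈ sphere (0 : ℂ) 1) (hν : ∀ᵐ x ∂ν, x ∈ sphere (0 : ℂ) 1)
    (h : ∀ n : ℕ, ∫ x, x ^ n ∂μ = ∫ x, x ^ n ∂ν) : μ = ν := by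
  have : Fact (0 < 2 * Real.pi) := ⟨Real.two_pi_pos⟩
  let a : ℂ → AddCircle (2 * Real.pi) := fun x => (x.arg : AddCircle (2 * Real.pi))
  let b : AddCircle (2 * Real.pi) → ℂ := fun t => (AddCircle.toCircle t : ℂ)
  have ha : Measurable a := (AddCircle.continuous_mk' _).measurable.comp Complex.measurable_arg
  have hb : Continuous b := continuous_subtype_val.comp AddCircle.continuous_toCircle
  have hba : ∀ x ∈ sphere (0 : ℂ) 1, b (a x) = x := by
    intro x hx
    have hx1 : ‖x‖ = 1 := by simpa using hx
    have h2 := Complex.norm_mul_exp_arg_mul_I x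
    simp only [b, a, AddCircle.toCircle_apply_mk, Circle.coe_exp]
    rw [hx1] at h2
    rw [div_self Real.two_pi_pos.ne', one_mul]
    simpa using h2
  have back : ∀ (ρ : Measure ℂ), (∀ᵐ x ∂ρ, x ∈ sphere (0 : ℂ) 1) → (ρ.map a).map b = ρ := by
    intro ρ hρ
    rw [Measure.map_map hb.measurable ha, Measure.map_congr (g := id), Measure.map_id]
    filter_upwards [hρ] with x hx using hba x hx
  have zmom : ∀ n : ℤ, ∫ x, x ^ n ∂μ = ∫ x, x ^ n ∂ν := by
    intro n
    obtain ⟨m, rfl | rfl⟩ := n.eq_nat_or_neg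
    · simpa using h m
    -- On the circle x⁻¹ is the conjugate of x, so negative moments come for free.
    · have hc : ∀ (ρ : Measure ℂ), (∀ᵐ x ∂ρ, x ∈ sphere (0 : ℂ) 1) →
          ∫ x, x ^ (-(m : ℤ)) ∂ρ = conj (∫ x, x ^ m ∂ρ) := by
        intro ρ hρ
        rw [← integral_conj]
        refine integral_congr_ae ?_
        filter_upwards [hρ] with x hx
        have hx1 : ‖x‖ = 1 := by simpa using hx
        rw [zpow_neg, zpow_natCast, map_pow, ← inv_pow, Complex.inv_eq_conj hx1]
      rw [hc μ hμ, hc ν hν, h m]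
  have four : ∀ (ρ : Measure ℂ), (∀ᵐ x ∂ρ, x ∈ sphere (0 : ℂ) 1) → ∀ n : ℤ,
      ∫ t, fourier n t ∂(ρ.map a) = ∫ x, x ^ n ∂ρ := by
    intro ρ hρ n
    rw [integral_map ha.aemeasurable (fourier n).continuous.aestronglyMeasurable]
    refine integral_congr_ae ?_
    filter_upwards [hρ] with x hx
    rw [fourier_apply, AddCircle.toCircle_zsmul, Circle.coe_zpow]
    exact congrArg (· ^ n) (hba x hx)
  have hmap : μ.map a = ν.map a := by
    -- Trigonometric polynomials form a star subalgebra separating points, so agreement on them is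
    -- enough.
    refine ext_of_forall_mem_subalgebra_integral_eq_of_polish (𝕜 := ℂ)
      (A := (fourierSubalgebra (T := 2 * Real.pi)).comap
        (BoundedContinuousFunction.toContinuousMapStarₐ ℂ)) ?_ ?_
    · intro x y hxy
      obtain ⟨_, ⟨g, hg, rfl⟩, hgxy⟩ := fourierSubalgebra_separatesPoints hxy
      exact ⟨g, ⟨g, ⟨BoundedContinuousFunction.mkOfCompact g, hg, rfl⟩, rfl⟩, hgxy⟩
    · intro g hg
      have hg' : (g : C(AddCircle (2 * Real.pi), ℂ)) ∈
          Submodule.span ℂ (Set.range (@fourier (2 * Real.pi))) := by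
        rw [← fourierSubalgebra_coe]
        exact hg
      have hint : ∀ (ρ : Measure (AddCircle (2 * Real.pi))) [IsFiniteMeasure ρ]
          (u : C(AddCircle (2 * Real.pi), ℂ)), Integrable u ρ := fun ρ _ u =>
        (BoundedContinuousFunction.mkOfCompact u).integrable ρ
      have := Submodule.span_induction
        (p := fun (u : C(AddCircle (2 * Real.pi), ℂ)) _ => ∫ t, u t ∂(μ.map a) = ∫ t, u t ∂(ν.map a))
        ?_ ?_ ?_ ?_ hg'
      · exact this
      · rintro _ ⟨n, rfl⟩
        rw [four μ hμ, four ν hν, zmom]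
      · simp
      · intro u v _ _ hu hv
        simp only [ContinuousMap.add_apply]
        rw [integral_add (hint _ u) (hint _ v), integral_add (hint _ u) (hint _ v), hu, hv]
      · intro c u _ hu
        simp only [ContinuousMap.smul_apply]
        rw [integral_smul, integral_smul, hu]
  rw [← back μ hμ, ← back ν hν, hmap]

/-! ### Harmonic measure and the Poisson formula. -/

lemma ae_mem_sphere : ∀ᵐ ξ ∂lebCircle, ξ ∈ sphere (0 : ℂ) 1 := by
  refine Measure.ae_smul_measure ?_ _
  rw [ae_map_iff (p := (· ∈ sphere (0 : ℂ) 1)) (by fun_prop) isClosed_sphere.measurableSet]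
  exact ae_of_all _ fun θ => by simp

instance : IsProbabilityMeasure lebCircle := by
  constructor
  rw [lebCircle, Measure.smul_apply, Measure.map_apply (by fun_prop) MeasurableSet.univ]
  simp only [Set.preimage_univ, Measure.restrict_apply, MeasurableSet.univ, Set.univ_inter,
    Real.volume_Ioc, sub_zero, smul_eq_mul]
  exact ENNReal.inv_mul_cancel (by simpa using Real.pi_pos) ENNReal.ofReal_ne_top

lemma integral_lebCircle {h : ℂ → ℂ} (hh : AEStronglyMeasurable h lebCircle) :
    ∫ ξ, h ξ ∂lebCircle = Real.circleAverage h 0 1 := by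
  have hne : (ENNReal.ofReal (2 * Real.pi))⁻¹ ≠ 0 := ENNReal.inv_ne_zero.2 ENNReal.ofReal_ne_top
  have hh' : AEStronglyMeasurable h
      ((volume.restrict (Set.Ioc 0 (2 * Real.pi))).map (circleMap 0 1)) :=
    hh.mono_ac (Measure.absolutelyContinuous_smul hne)
  rw [lebCircle, integral_smul_measure, integral_map (by fun_prop) hh', Real.circleAverage_def,
    intervalIntegral.integral_of_le Real.two_pi_pos.le, ENNReal.toReal_inv,
    ENNReal.toReal_ofReal Real.two_pi_pos.le]

lemma measurable_inv_sq_enorm_sub (p : ℂ) : Measurable fun ξ : ℂ => (‖ξ - p‖ₑ ^ 2)⁻¹ := by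
  fun_prop

lemma muMeasure_absolutelyContinuous (p : ℂ) : muMeasure p ≪ lebCircle :=
  withDensity_absolutelyContinuous _ _

/-- Harmonic measure of the disc seen from `z`. -/
noncomputable def harmonicMeasure (z : ℂ) : Measure ℂ := ENNReal.ofReal (1 - ‖z‖ ^ 2) • muMeasure z

lemma harmonicMeasure_absolutelyContinuous (z : ℂ) : harmonicMeasure z ≪ lebCircle :=
  (Measure.smul_absolutelyContinuous).trans (muMeasure_absolutelyContinuous z)

lemma one_sub_norm_le_norm_sub {z ξ : ℂ} (hξ : ξ ∈ sphere (0 : ℂ) 1) : 1 - ‖z‖ ≤ ‖ξ - z‖ := by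
  have h1 : ‖ξ‖ = 1 := by simpa using hξ
  have := norm_sub_norm_le ξ z
  linarith

lemma isFiniteMeasure_muMeasure {z : ℂ} (hz : z ∈ ball (0 : ℂ) 1) :
    IsFiniteMeasure (muMeasure z) := by
  have hz1 : 0 < 1 - ‖z‖ := by simpa using hz
  refine isFiniteMeasure_withDensity (ne_of_lt ?_)
  calc ∫⁻ ξ, (‖ξ - z‖ₑ ^ 2)⁻¹ ∂lebCircle
      ≤ ∫⁻ _, (ENNReal.ofReal (1 - ‖z‖) ^ 2)⁻¹ ∂lebCircle := by
        refine lintegral_mono_ae ?_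
        filter_upwards [ae_mem_sphere] with ξ hξ
        rw [← ofReal_norm]
        gcongr
        exact one_sub_norm_le_norm_sub hξ
    _ < ∞ := by
        rw [lintegral_const, measure_univ, mul_one]
        exact ENNReal.inv_lt_top.2 (ENNReal.pow_pos (ENNReal.ofReal_pos.2 hz1) 2)

lemma isFiniteMeasure_harmonicMeasure {z : ℂ} (hz : z ∈ ball (0 : ℂ) 1) :
    IsFiniteMeasure (harmonicMeasure z) := by
  have := isFiniteMeasure_muMeasure hz
  exact ⟨ENNReal.mul_lt_top ENNReal.ofReal_lt_top (measure_lt_top _ _)⟩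

lemma integral_harmonicMeasure {z : ℂ} (hz : z ∈ ball (0 : ℂ) 1) (h : ℂ → ℂ) :
    ∫ ξ, h ξ ∂harmonicMeasure z = ∫ ξ, (poissonKernel 0 z • h) ξ ∂lebCircle := by
  have hz1 : 0 < 1 - ‖z‖ := by simpa using hz
  have hz2 : 0 ≤ 1 - ‖z‖ ^ 2 := by nlinarith [norm_nonneg z]
  have hlt : ∀ᵐ ξ ∂lebCircle, (‖ξ - z‖ₑ ^ 2)⁻¹ < ∞ := by
    filter_upwards [ae_mem_sphere] with ξ hξ
    have h0 : 0 < ‖ξ - z‖ := hz1.trans_le (one_sub_norm_le_norm_sub hξ)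
    exact ENNReal.inv_lt_top.2 (ENNReal.pow_pos (enorm_pos.2 (norm_pos_iff.1 h0)) 2)
  rw [harmonicMeasure, integral_smul_measure, muMeasure,
    integral_withDensity_eq_integral_toReal_smul (measurable_inv_sq_enorm_sub z) hlt,
    ← integral_smul]
  refine integral_congr_ae ?_
  filter_upwards [ae_mem_sphere] with ξ hξ
  have h1 : ‖ξ‖ = 1 := by simpa using hξ
  simp only [Pi.smul_apply', poissonKernel_def, sub_zero, h1, one_pow, smul_smul]
  rw [ENNReal.toReal_ofReal hz2, ENNReal.toReal_inv, ENNReal.toReal_pow, toReal_enorm,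
    div_eq_mul_inv]

lemma aestronglyMeasurable_of_continuousOn_sphere {h : ℂ → ℂ} (hh : ContinuousOn h (sphere 0 1)) :
    AEStronglyMeasurable h lebCircle := by
  have h1 := hh.aestronglyMeasurable (μ := lebCircle) isClosed_sphere.measurableSet
  rwa [Measure.restrict_eq_self_of_ae_mem ae_mem_sphere] at h1

lemma continuousOn_poissonKernel_sphere {z : ℂ} (hz : z ∈ ball (0 : ℂ) 1) :
    ContinuousOn (poissonKernel 0 z) (sphere 0 1) := by
  have hz1 : 0 < 1 - ‖z‖ := by simpa using hz
  have : poissonKernel 0 z = fun ξ => (‖ξ - 0‖ ^ 2 - ‖z - 0‖ ^ 2) / ‖(ξ - 0) - (z - 0)‖ ^ 2 :=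
    funext fun ξ => poissonKernel_def _ _ _
  rw [this]
  refine ContinuousOn.div (by fun_prop) (by fun_prop) fun ξ hξ => ?_
  have h0 : 0 < ‖ξ - z‖ := hz1.trans_le (one_sub_norm_le_norm_sub hξ)
  simpa using norm_pos_iff.1 h0

/-- **Poisson formula** for functions holomorphic in the disc and continuous on its closure. -/
lemma integral_harmonicMeasure_of_diffContOnCl {h : ℂ → ℂ} (hh : DiffContOnCl ℂ h (ball 0 1))
    {z : ℂ} (hz : z ∈ ball (0 : ℂ) 1) : ∫ ξ, h ξ ∂harmonicMeasure z = h z := by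
  have hc : ContinuousOn h (sphere 0 1) := hh.continuousOn_ball.mono sphere_subset_closedBall
  rw [integral_harmonicMeasure hz, integral_lebCircle, hh.circleAverage_poissonKernel_smul hz]
  exact aestronglyMeasurable_of_continuousOn_sphere ((continuousOn_poissonKernel_sphere hz).smul hc)

lemma mul_mem_ball {r : ℝ} (hr0 : 0 < r) (hr1 : r < 1) {ξ : ℂ} (hξ : ‖ξ‖ ≤ 1) :
    (r : ℂ) * ξ ∈ ball (0 : ℂ) 1 := by
  rw [mem_ball_zero_iff, norm_mul, Complex.norm_real, Real.norm_of_nonneg hr0.le]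
  nlinarith [norm_nonneg ξ]

lemma eventually_pos_lt_one : ∀ᶠ r : ℝ in 𝓝[<] (1 : ℝ), 0 < r ∧ r < 1 :=
  Ioo_mem_nhdsLT zero_lt_one

/-- **Poisson formula** for bounded holomorphic functions in terms of their radial limits. -/
lemma integral_harmonicMeasure_of_radialLimit {h g : ℂ → ℂ} (hh : DifferentiableOn ℂ h (ball 0 1))
    (hb : ∀ z ∈ ball (0 : ℂ) 1, ‖h z‖ ≤ 1) (hg : ∀ᵐ ξ ∂lebCircle, HasRadialLimit h ξ (g ξ))
    {z : ℂ} (hz : z ∈ ball (0 : ℂ) 1) : ∫ ξ, g ξ ∂harmonicMeasure z = h z := by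
  have := isFiniteMeasure_harmonicMeasure hz
  have hac := harmonicMeasure_absolutelyContinuous z
  -- The dilates ξ ↦ h(rξ) are continuous up to the boundary; the constant 1 then dominates as r →
  -- 1.
  have hcl : ∀ r : ℝ, 0 < r → r < 1 → DiffContOnCl ℂ (fun ξ => h (r * ξ)) (ball 0 1) := by
    intro r hr0 hr1
    apply DifferentiableOn.diffContOnCl
    rw [closure_ball 0 one_ne_zero]
    exact hh.comp (by fun_prop) fun ξ hξ => mul_mem_ball hr0 hr1 (by simpa using hξ)
  have hlim : Tendsto (fun r : ℝ => ∫ ξ, h (r * ξ) ∂harmonicMeasure z) (𝓝[<] 1)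
      (𝓝 (∫ ξ, g ξ ∂harmonicMeasure z)) := by
    refine tendsto_integral_filter_of_dominated_convergence (fun _ => 1) ?_ ?_
      (integrable_const _) (hac.ae_le hg)
    · filter_upwards [eventually_pos_lt_one] with r hr
      exact (aestronglyMeasurable_of_continuousOn_sphere
        ((hcl r hr.1 hr.2).continuousOn_ball.mono sphere_subset_closedBall)).mono_ac hac
    · filter_upwards [eventually_pos_lt_one] with r hr
      filter_upwards [hac.ae_le ae_mem_sphere] with ξ hξ
      exact hb _ (mul_mem_ball hr.1 hr.2 (by simpa using (mem_sphere_zero_iff_norm.1 hξ).le))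
  have hlim2 : Tendsto (fun r : ℝ => h (r * z)) (𝓝[<] 1) (𝓝 (h z)) := by
    have hc : ContinuousAt (fun r : ℝ => h (r * z)) 1 := by
      have h1 : ContinuousAt h (((1 : ℝ) : ℂ) * z) := by
        simpa using hh.continuousOn.continuousAt (isOpen_ball.mem_nhds hz)
      exact ContinuousAt.comp (f := fun r : ℝ => (r : ℂ) * z) h1 (by fun_prop)
    simpa using hc.tendsto.mono_left nhdsWithin_le_nhds
  refine tendsto_nhds_unique hlim (hlim2.congr' ?_)
  filter_upwards [eventually_pos_lt_one] with r hr
  exact (integral_harmonicMeasure_of_diffContOnCl (hcl r hr.1 hr.2) hz).symm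

lemma HasRadialLimit.pow {f : ℂ → ℂ} {ξ w : ℂ} (h : HasRadialLimit f ξ w) (n : ℕ) :
    HasRadialLimit (fun z => f z ^ n) ξ (w ^ n) :=
  Tendsto.pow h n

lemma hasRadialLimit_id (ξ : ℂ) : HasRadialLimit (fun z => z) ξ ξ := by
  have : Continuous fun r : ℝ => (r : ℂ) * ξ := by fun_prop
  simpa [HasRadialLimit] using (this.tendsto 1).mono_left nhdsWithin_le_nhds

lemma integral_pow_harmonicMeasure {f g : ℂ → ℂ} (hf : DifferentiableOn ℂ f (ball 0 1))
    (hm : Set.MapsTo f (ball 0 1) (ball 0 1)) (hg : ∀ᵐ ξ ∂lebCircle, HasRadialLimit f ξ (g ξ))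
    {z : ℂ} (hz : z ∈ ball (0 : ℂ) 1) (n : ℕ) : ∫ ξ, g ξ ^ n ∂harmonicMeasure z = f z ^ n := by
  refine integral_harmonicMeasure_of_radialLimit (h := fun z => f z ^ n) (hf.pow n)
    (fun w hw => ?_) (hg.mono fun ξ h => h.pow n) hz
  have : ‖f w‖ < 1 := by simpa using hm hw
  rw [norm_pow]
  exact pow_le_one₀ (norm_nonneg _) this.le

/-! ### The boundary map and Löwner's lemma. -/

/-- The boundary map of `f`. -/
noncomputable def radialLimit (f : ℂ → ℂ) (ξ : ℂ) : ℂ :=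
  limUnder (𝓝[<] (1 : ℝ)) fun r : ℝ => f ((r : ℂ) * ξ)

lemma HasRadialLimit.radialLimit_eq {f : ℂ → ℂ} {ξ w : ℂ} (h : HasRadialLimit f ξ w) :
    radialLimit f ξ = w :=
  Tendsto.limUnder_eq h

lemma IsInner.ae_hasRadialLimit {f : ℂ → ℂ} (hf : IsInner f) :
    ∀ᵐ ξ ∂lebCircle, HasRadialLimit f ξ (radialLimit f ξ) ∧ radialLimit f ξ ∈ sphere (0 : ℂ) 1 := by
  filter_upwards [hf.radial] with ξ ⟨w, hw, h⟩
  rw [h.radialLimit_eq]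
  exact ⟨h, hw⟩

lemma IsInner.aemeasurable_radialLimit {f : ℂ → ℂ} (hf : IsInner f) :
    AEMeasurable (radialLimit f) lebCircle := by
  classical
  -- Outside the disc `f` is arbitrary, so it is replaced by 0 there to get measurability.
  have hm : Measurable ((ball (0 : ℂ) 1).piecewise f 0) :=
    hf.differentiableOn.continuousOn.measurable_piecewise continuousOn_const measurableSet_ball
  refine aemeasurable_of_tendsto_metrizable_ae (𝓝[<] (1 : ℝ))
    (f := fun (r : ℝ) ξ => (ball (0 : ℂ) 1).piecewise f 0 (r * ξ))
    (fun r => (hm.comp (measurable_const_mul (r : ℂ))).aemeasurable) ?_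
  filter_upwards [hf.ae_hasRadialLimit, ae_mem_sphere] with ξ h hξ
  refine Tendsto.congr' ?_ h.1
  filter_upwards [eventually_pos_lt_one] with r hr
  rw [Set.piecewise_eq_of_mem]
  exact mul_mem_ball hr.1 hr.2 (mem_sphere_zero_iff_norm.1 hξ).le

/-- **Löwner's lemma**: the boundary map of an inner function transports harmonic measures. -/
theorem IsInner.map_harmonicMeasure {f : ℂ → ℂ} (hf : IsInner f) {z : ℂ}
    (hz : z ∈ ball (0 : ℂ) 1) :
    (harmonicMeasure z).map (radialLimit f) = harmonicMeasure (f z) := by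
  have hfz := hf.mapsTo hz
  have := isFiniteMeasure_harmonicMeasure hz
  have := isFiniteMeasure_harmonicMeasure hfz
  have hac := harmonicMeasure_absolutelyContinuous z
  have hg : AEMeasurable (radialLimit f) (harmonicMeasure z) :=
    hf.aemeasurable_radialLimit.mono_ac hac
  refine measure_ext_of_moments ?_
    ((harmonicMeasure_absolutelyContinuous (f z)).ae_le ae_mem_sphere) fun n => ?_
  · rw [ae_map_iff (p := (· ∈ sphere (0 : ℂ) 1)) hg isClosed_sphere.measurableSet]
    exact hac.ae_le (hf.ae_hasRadialLimit.mono fun ξ h => h.2)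
  -- Both moments equal f(z)ⁿ; the second is the Poisson formula for the identity map at the point
  -- f(z).
  · rw [integral_map hg (by fun_prop),
      integral_pow_harmonicMeasure hf.differentiableOn hf.mapsTo
        (hf.ae_hasRadialLimit.mono fun ξ h => h.1) hz,
      integral_pow_harmonicMeasure (f := fun z => z) (g := fun z => z) differentiableOn_id
        (Set.mapsTo_id _) (ae_of_all _ hasRadialLimit_id) hfz]

/-! ### Radial consequences of the angular derivative. -/

lemma tendsto_radius_stolzAngle {p : ℂ} (hp : p ∈ sphere (0 : ℂ) 1) {β : ℝ} (hβ : 1 < β) :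
    Tendsto (fun r : ℝ => (r : ℂ) * p) (𝓝[<] 1) (𝓝[stolzAngle β p] p) := by
  have hp1 : ‖p‖ = 1 := by simpa using hp
  refine tendsto_nhdsWithin_iff.2 ⟨hasRadialLimit_id p, ?_⟩
  filter_upwards [eventually_pos_lt_one] with r hr
  refine ⟨mul_mem_ball hr.1 hr.2 hp1.le, ?_⟩
  have h1 : ‖(r : ℂ) * p - p‖ = 1 - r := by
    rw [← sub_one_mul, norm_mul, hp1, mul_one, ← Complex.ofReal_one, ← Complex.ofReal_sub,
      Complex.norm_real, Real.norm_eq_abs, abs_sub_comm, abs_of_pos (by linarith [hr.2])]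
  rw [h1, norm_mul, hp1, mul_one, Complex.norm_real, Real.norm_of_nonneg hr.1.le]
  nlinarith [hr.2]

/-- Shows that the choice of η and β is immaterial: every Stolz angle contains the end of the
radius, and a finite limit forces η = q because the denominator vanishes there. -/
lemma HasAngularDeriv.mul_eq_one {f : ℂ → ℂ} (hm : Set.MapsTo f (ball 0 1) (ball 0 1)) {p q : ℂ}
    (hp : p ∈ sphere (0 : ℂ) 1) (hq : q ∈ sphere (0 : ℂ) 1) (hpq : HasRadialLimit f p q) {a : ℂ}
    (hlim : Tendsto (fun z => (p - z) / (q - f z)) (𝓝[stolzAngle 2 p] p) (𝓝 a)) {d : ℂ}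
    (hd : HasAngularDeriv f p d) : d * a = 1 := by
  obtain ⟨η, hη, β, hβ, hd⟩ := hd
  have h1 := hd.comp (tendsto_radius_stolzAngle hp hβ)
  have h2 := hlim.comp (tendsto_radius_stolzAngle hp one_lt_two)
  have hne : ∀ᶠ r : ℝ in 𝓝[<] 1, p - r * p ≠ 0 ∧ q - f (r * p) ≠ 0 := by
    filter_upwards [eventually_pos_lt_one] with r hr
    have hb := mul_mem_ball hr.1 hr.2 (mem_sphere_zero_iff_norm.1 hp).le
    exact ⟨sub_ne_zero_of_sphere hp hb, sub_ne_zero_of_sphere hq (hm hb)⟩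
  have hηq : η = q := by
    have h3 : Tendsto (fun r : ℝ => p - r * p) (𝓝[<] 1) (𝓝 (p - p)) :=
      tendsto_const_nhds.sub (hasRadialLimit_id p)
    have h4 := h1.mul h3
    have h5 : Tendsto (fun r : ℝ => η - f (r * p)) (𝓝[<] 1) (𝓝 (η - q)) :=
      tendsto_const_nhds.sub hpq
    have h6 := tendsto_nhds_unique (h4.congr' ?_) h5
    · rw [sub_self, mul_zero] at h6
      exact sub_eq_zero.1 h6.symm
    · filter_upwards [hne] with r hr
      exact div_mul_cancel₀ _ hr.1
  subst hηq
  refine tendsto_nhds_unique ((h1.mul h2).congr' ?_) tendsto_const_nhds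
  filter_upwards [hne] with r hr
  rw [Function.comp_apply, Function.comp_apply, div_mul_div_cancel₀ hr.1, div_self hr.2]

/-- The chosen derivative is pinned down by `HasAngularDeriv.mul_eq_one`. Conversely c ≠ 0 would
make the inverted quotient converge, so absence of a derivative means c = 0, where the `ℝ≥0∞`
inverse is ∞. -/
lemma absAngularDeriv_eq {f : ℂ → ℂ} (hm : Set.MapsTo f (ball 0 1) (ball 0 1)) {p q : ℂ}
    (hp : p ∈ sphere (0 : ℂ) 1) (hq : q ∈ sphere (0 : ℂ) 1) (hpq : HasRadialLimit f p q) {c : ℝ}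
    (hc : 0 ≤ c)
    (hlim : Tendsto (fun z => (p - z) / (q - f z)) (𝓝[stolzAngle 2 p] p) (𝓝 (c * p / q))) :
    absAngularDeriv f p = (ENNReal.ofReal c)⁻¹ := by
  have hp1 : ‖p‖ = 1 := by simpa using hp
  have hq1 : ‖q‖ = 1 := by simpa using hq
  have hp0 : p ≠ 0 := norm_ne_zero_iff.1 (by rw [hp1]; exact one_ne_zero)
  have hq0 : q ≠ 0 := norm_ne_zero_iff.1 (by rw [hq1]; exact one_ne_zero)
  unfold absAngularDeriv
  split_ifs with h
  · have h1 := congrArg norm (h.choose_spec.mul_eq_one hm hp hq hpq hlim)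
    rw [norm_mul, norm_div, norm_mul, hp1, hq1, Complex.norm_real, Real.norm_of_nonneg hc,
      norm_one, mul_one, div_one] at h1
    have hc0 : 0 < c := hc.lt_of_ne (by rintro rfl; simp at h1)
    rw [← ofReal_norm, eq_inv_of_mul_eq_one_left h1, ENNReal.ofReal_inv_of_pos hc0]
  · have hc0 : c = 0 := by
      by_contra hne
      have hne' : (c : ℂ) * p / q ≠ 0 :=
        div_ne_zero (mul_ne_zero (Complex.ofReal_ne_zero.2 hne) hp0) hq0
      refine h ⟨_, q, hq, 2, one_lt_two, (hlim.inv₀ hne').congr fun z => ?_⟩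
      rw [inv_div]
    simp [hc0]

lemma tendsto_sub_div_one_sub {f : ℂ → ℂ} {p q : ℂ} (hp : p ∈ sphere (0 : ℂ) 1)
    (hq : q ∈ sphere (0 : ℂ) 1) {c : ℝ} (hc : 0 < c)
    (hlim : Tendsto (fun z => (p - z) / (q - f z)) (𝓝[stolzAngle 2 p] p) (𝓝 (c * p / q))) :
    Tendsto (fun r : ℝ => (q - f (r * p)) / ((1 - r : ℝ) : ℂ)) (𝓝[<] 1) (𝓝 (q / c)) := by
  have hp0 : p ≠ 0 := norm_ne_zero_iff.1 (by rw [mem_sphere_zero_iff_norm.1 hp]; exact one_ne_zero)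
  have hq0 : q ≠ 0 := norm_ne_zero_iff.1 (by rw [mem_sphere_zero_iff_norm.1 hq]; exact one_ne_zero)
  have hc0 : (c : ℂ) ≠ 0 := Complex.ofReal_ne_zero.2 hc.ne'
  have hne : (c : ℂ) * p / q ≠ 0 := div_ne_zero (mul_ne_zero hc0 hp0) hq0
  have h1 := ((hlim.comp (tendsto_radius_stolzAngle hp one_lt_two)).inv₀ hne).mul_const p
  rw [show ((c : ℂ) * p / q)⁻¹ * p = q / c by field_simp] at h1
  refine h1.congr fun r => ?_
  simp only [Function.comp_apply, inv_div]
  rw [← one_sub_mul, div_mul_eq_mul_div, mul_div_mul_right _ _ hp0]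
  push_cast
  rfl

lemma one_sub_sq_norm_eq {q w : ℂ} (hq : q ∈ sphere (0 : ℂ) 1) :
    1 - ‖w‖ ^ 2 = 2 * (conj q * (q - w)).re - ‖q - w‖ ^ 2 := by
  have hq1 : ‖q‖ ^ 2 = 1 := by simp [mem_sphere_zero_iff_norm.1 hq]
  rw [← hq1]
  simp only [Complex.sq_norm, Complex.normSq_apply, Complex.mul_re, Complex.sub_re, Complex.sub_im,
    Complex.conj_re, Complex.conj_im]
  ring

/-- In `one_sub_sq_norm_eq` the quadratic term is o(1 - r), and the linear term is read off from the
radial difference quotient. -/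
lemma tendsto_one_sub_sq_norm_div {f : ℂ → ℂ} {p q : ℂ} (hp : p ∈ sphere (0 : ℂ) 1)
    (hq : q ∈ sphere (0 : ℂ) 1) (hpq : HasRadialLimit f p q) {c : ℝ} (hc : 0 < c)
    (hlim : Tendsto (fun z => (p - z) / (q - f z)) (𝓝[stolzAngle 2 p] p) (𝓝 (c * p / q))) :
    Tendsto (fun r : ℝ => (1 - ‖f (r * p)‖ ^ 2) / (1 - r)) (𝓝[<] 1) (𝓝 (2 / c)) := by
  have hq1 : ‖q‖ = 1 := by simpa using hq
  have h1 := tendsto_sub_div_one_sub hp hq hc hlim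
  have h2 : Tendsto (fun r : ℝ => ‖q - f (r * p)‖) (𝓝[<] 1) (𝓝 0) := by
    have : Tendsto (fun r : ℝ => q - f (r * p)) (𝓝[<] 1) (𝓝 (q - q)) :=
      tendsto_const_nhds.sub hpq
    simpa using this.norm
  have h3 := (Complex.continuous_re.tendsto _).comp (h1.const_mul (conj q))
  have h4 := (h3.const_mul 2).sub (h1.norm.mul h2)
  have h5 : 2 * (conj q * (q / c)).re - ‖q / (c : ℂ)‖ * 0 = 2 / c := by
    rw [← mul_div_assoc, ← Complex.normSq_eq_conj_mul_self, Complex.normSq_eq_norm_sq, hq1,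
      ← Complex.ofReal_div, Complex.ofReal_re]
    ring
  rw [h5] at h4
  refine h4.congr' ?_
  filter_upwards [eventually_pos_lt_one] with r hr
  have hr1 : 0 < 1 - r := by linarith [hr.2]
  rw [Function.comp_apply, one_sub_sq_norm_eq hq, ← mul_div_assoc, Complex.div_ofReal_re, norm_div,
    Complex.norm_real, Real.norm_of_nonneg hr1.le]
  ring

/-- Nontangential approach of f(rp) to q: |q - f| is asymptotic to (1 - r)/c and 1 - |f|² to twice
that, and 1 - |f|² ≤ 2(1 - |f|). -/
lemma eventually_norm_sub_le {f : ℂ → ℂ} (hm : Set.MapsTo f (ball 0 1) (ball 0 1)) {p q : ℂ}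
    (hp : p ∈ sphere (0 : ℂ) 1)
    (hq : q ∈ sphere (0 : ℂ) 1) (hpq : HasRadialLimit f p q) {c : ℝ} (hc : 0 < c)
    (hlim : Tendsto (fun z => (p - z) / (q - f z)) (𝓝[stolzAngle 2 p] p) (𝓝 (c * p / q))) :
    ∀ᶠ r : ℝ in 𝓝[<] 1, ‖f (r * p) - q‖ ≤ 2 * (1 - ‖f (r * p)‖) := by
  have h1 := (tendsto_sub_div_one_sub hp hq hc hlim).norm
  have h2 := tendsto_one_sub_sq_norm_div hp hq hpq hc hlim
  have hlt : ‖q / (c : ℂ)‖ < 2 / c := by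
    rw [norm_div, mem_sphere_zero_iff_norm.1 hq, Complex.norm_real, Real.norm_of_nonneg hc.le]
    gcongr
    exact one_lt_two
  filter_upwards [h1.eventually_lt h2 hlt, eventually_pos_lt_one] with r h hr
  have hr1 : 0 < 1 - r := by linarith [hr.2]
  have hf1 : ‖f (r * p)‖ < 1 := by
    simpa using hm (mul_mem_ball hr.1 hr.2 (mem_sphere_zero_iff_norm.1 hp).le)
  rw [norm_div, Complex.norm_real, Real.norm_of_nonneg hr1.le, div_lt_div_iff_of_pos_right hr1] at h
  rw [norm_sub_rev]
  nlinarith [norm_nonneg (f (r * p))]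

lemma norm_radius {p : ℂ} (hp : p ∈ sphere (0 : ℂ) 1) {r : ℝ} (hr : 0 < r) :
    ‖(r : ℂ) * p‖ = r := by
  rw [norm_mul, mem_sphere_zero_iff_norm.1 hp, mul_one, Complex.norm_real,
    Real.norm_of_nonneg hr.le]

/-- **Julia's lemma**: if `(1 - |f|²) / (1 - |z|²)` is frequently less than `M` along the radius
ending at `p`, then `f` satisfies Julia's inequality with constant `M`. -/
lemma julia_of_frequently {f : ℂ → ℂ} (hf : DifferentiableOn ℂ f (ball 0 1))
    (hm : Set.MapsTo f (ball 0 1) (ball 0 1)) {p q : ℂ} (hp : p ∈ sphere (0 : ℂ) 1)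
    (hpq : HasRadialLimit f p q) {M : ℝ}
    (hM : ∃ᶠ r : ℝ in 𝓝[<] 1, 1 - ‖f (r * p)‖ ^ 2 < M * (1 - r ^ 2)) {z : ℂ}
    (hz : z ∈ ball (0 : ℂ) 1) :
    ‖q - f z‖ ^ 2 * (1 - ‖z‖ ^ 2) ≤ M * ((1 - ‖f z‖ ^ 2) * ‖p - z‖ ^ 2) := by
  have h1 : Tendsto (fun r : ℝ => ‖f (r * p) - f z‖ ^ 2 * (1 - ‖z‖ ^ 2) -
      M * ((1 - ‖f z‖ ^ 2) * ‖r * p - z‖ ^ 2)) (𝓝[<] 1)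
      (𝓝 (‖q - f z‖ ^ 2 * (1 - ‖z‖ ^ 2) - M * ((1 - ‖f z‖ ^ 2) * ‖p - z‖ ^ 2))) :=
    (((Tendsto.sub_const hpq _).norm.pow 2).mul_const _).sub
      ((((Tendsto.sub_const (hasRadialLimit_id p) _).norm.pow 2).const_mul _).const_mul _)
  refine sub_nonpos.1 (le_of_tendsto_of_frequently h1 ?_)
  refine (hM.and_eventually eventually_pos_lt_one).mono fun r ⟨hr, hr0, hr1⟩ => sub_nonpos.2 ?_
  have hb := mul_mem_ball hr0 hr1 (mem_sphere_zero_iff_norm.1 hp).le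
  have key := schwarz_pick_of_mapsTo_ball hf hm hb hz
  have hrb := one_sub_sq_norm_pos hb
  rw [norm_radius hp hr0] at key hrb
  have h3 : 0 ≤ ‖r * p - z‖ ^ 2 * (1 - ‖f z‖ ^ 2) :=
    mul_nonneg (by positivity) (one_sub_sq_norm_pos (hm hz)).le
  have h4 := mul_le_mul_of_nonneg_left hr.le h3
  refine le_of_mul_le_mul_right ?_ hrb
  linarith

/-! ### Boundary limits of the measures μ_ζ. -/

/-- The measures `muMeasure ζ` are lower semicontinuous in `ζ`. -/
lemma muMeasure_le_liminf {ι : Type*} {l : Filter ι} [l.IsCountablyGenerated] [l.NeBot]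
    {ζ : ι → ℂ} {p : ℂ} (hζ : Tendsto ζ l (𝓝 p)) (A : Set ℂ) :
    muMeasure p A ≤ liminf (fun i => muMeasure (ζ i) A) l := by
  simp only [muMeasure, withDensity_apply']
  refine le_trans (le_of_eq ?_) (lintegral_liminf_le fun i => measurable_inv_sq_enorm_sub (ζ i))
  refine lintegral_congr fun ξ => (Tendsto.liminf_eq ?_).symm
  exact ((ENNReal.continuous_pow 2).tendsto _ |>.comp (hζ.const_sub ξ).enorm).inv

/-- The measures `muMeasure ζ` converge as `ζ` tends nontangentially to the circle. -/
lemma tendsto_muMeasure {ι : Type*} {l : Filter ι} [l.IsCountablyGenerated] [l.NeBot]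
    {ζ : ι → ℂ} {p : ℂ} (hζ : Tendsto ζ l (𝓝 p)) {C : ℝ} (hC : 0 ≤ C)
    (hnt : ∀ᶠ i in l, ‖ζ i - p‖ ≤ C * (1 - ‖ζ i‖)) (A : Set ℂ) :
    Tendsto (fun i => muMeasure (ζ i) A) l (𝓝 (muMeasure p A)) := by
  by_cases htop : muMeasure p A = ∞
  · have h := muMeasure_le_liminf hζ A
    rw [htop] at h ⊢
    exact tendsto_of_le_liminf_of_limsup_le h le_top
  simp only [muMeasure, withDensity_apply'] at htop ⊢
  -- Nontangential approach gives |ξ - p| ≤ (1 + C)|ξ - ζ|, hence a multiple of the limiting density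
  -- as dominating function, integrable in the remaining case.
  refine tendsto_lintegral_filter_of_dominated_convergence
    (fun ξ => ENNReal.ofReal (1 + C) ^ 2 * (‖ξ - p‖ₑ ^ 2)⁻¹)
    (Eventually.of_forall fun i => measurable_inv_sq_enorm_sub (ζ i)) ?_ ?_ ?_
  · filter_upwards [hnt] with i hi
    refine ae_restrict_of_ae ?_
    filter_upwards [ae_mem_sphere] with ξ hξ
    have h1 := one_sub_norm_le_norm_sub (z := ζ i) hξ
    have h2 : ‖ξ - p‖ ≤ (1 + C) * ‖ξ - ζ i‖ := by
      calc ‖ξ - p‖ = ‖(ξ - ζ i) + (ζ i - p)‖ := by ring_nf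
        _ ≤ ‖ξ - ζ i‖ + ‖ζ i - p‖ := norm_add_le _ _
        _ ≤ ‖ξ - ζ i‖ + C * ‖ξ - ζ i‖ := by grw [hi, h1]
        _ = _ := by ring
    have h3 : ‖ξ - p‖ₑ ≤ ENNReal.ofReal (1 + C) * ‖ξ - ζ i‖ₑ := by
      rw [← ofReal_norm, ← ofReal_norm, ← ENNReal.ofReal_mul (by positivity)]
      exact ENNReal.ofReal_le_ofReal h2
    have hK0 : ENNReal.ofReal (1 + C) ^ 2 ≠ 0 :=
      pow_ne_zero 2 (ENNReal.ofReal_pos.2 (by positivity)).ne'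
    have hKt : ENNReal.ofReal (1 + C) ^ 2 ≠ ∞ := ENNReal.pow_ne_top ENNReal.ofReal_ne_top
    calc (‖ξ - ζ i‖ₑ ^ 2)⁻¹
        = ENNReal.ofReal (1 + C) ^ 2 * ((ENNReal.ofReal (1 + C) * ‖ξ - ζ i‖ₑ) ^ 2)⁻¹ := by
          rw [mul_pow, ENNReal.mul_inv (Or.inl hK0) (Or.inl hKt), ← mul_assoc,
            ENNReal.mul_inv_cancel hK0 hKt, one_mul]
      _ ≤ _ := by gcongr
  · rw [lintegral_const_mul _ (measurable_inv_sq_enorm_sub p)]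
    exact ENNReal.mul_ne_top (ENNReal.pow_ne_top ENNReal.ofReal_ne_top) htop
  · exact ae_of_all _ fun ξ =>
      ((ENNReal.continuous_pow 2).tendsto _ |>.comp (hζ.const_sub ξ).enorm).inv

/-! ### Boundary preimages of measurable sets. -/

lemma harmonicMeasure_zero : harmonicMeasure 0 = lebCircle := by
  rw [harmonicMeasure, muMeasure, withDensity_congr_ae (g := 1), withDensity_one]
  · simp
  · filter_upwards [ae_mem_sphere] with ξ hξ
    rw [sub_zero, ← ofReal_norm, mem_sphere_zero_iff_norm.1 hξ]
    simp

lemma lebCircle_absolutelyContinuous (p : ℂ) : lebCircle ≪ muMeasure p :=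
  withDensity_absolutelyContinuous' (measurable_inv_sq_enorm_sub p).aemeasurable
    (ae_of_all _ fun _ => ENNReal.inv_ne_zero.2 (ENNReal.pow_ne_top enorm_ne_top))

lemma IsInner.boundaryPreimage_ae_eq {f : ℂ → ℂ} (hf : IsInner f) (E : Set ℂ) :
    boundaryPreimage f E =ᵐ[lebCircle] radialLimit f ⁻¹' E := by
  filter_upwards [hf.ae_hasRadialLimit, ae_mem_sphere] with ξ h hξ
  refine propext ⟨?_, fun hE => ⟨hξ, _, hE, h.1⟩⟩
  rintro ⟨-, w, hw, hw'⟩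
  change radialLimit f ξ ∈ E
  rwa [hw'.radialLimit_eq]

lemma IsInner.map_lebCircle_absolutelyContinuous {f : ℂ → ℂ} (hf : IsInner f) :
    lebCircle.map (radialLimit f) ≪ lebCircle := by
  rw [← harmonicMeasure_zero, hf.map_harmonicMeasure (by simp), harmonicMeasure_zero]
  exact harmonicMeasure_absolutelyContinuous _

lemma IsInner.nullMeasurableSet_boundaryPreimage {f : ℂ → ℂ} (hf : IsInner f) {E : Set ℂ}
    (hE : NullMeasurableSet E lebCircle) :
    NullMeasurableSet (boundaryPreimage f E) lebCircle := by
  refine NullMeasurableSet.congr ?_ (hf.boundaryPreimage_ae_eq E).symm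
  have hg := hf.aemeasurable_radialLimit
  -- Löwner's lemma at 0 makes preimages of null sets null, so Lebesgue measurability, not just
  -- Borel, pulls back.
  have hq : Measure.QuasiMeasurePreserving (hg.mk _) lebCircle lebCircle :=
    ⟨hg.measurable_mk, by
      rw [← Measure.map_congr hg.ae_eq_mk]
      exact hf.map_lebCircle_absolutelyContinuous⟩
  exact (hE.preimage hq).congr (hg.ae_eq_mk.preimage E).symm

lemma IsInner.harmonicMeasure_boundaryPreimage {f : ℂ → ℂ} (hf : IsInner f) {E : Set ℂ}
    (hE : NullMeasurableSet E lebCircle) {z : ℂ} (hz : z ∈ ball (0 : ℂ) 1) :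
    harmonicMeasure z (boundaryPreimage f E) = harmonicMeasure (f z) E := by
  have hac := harmonicMeasure_absolutelyContinuous z
  rw [measure_congr (hac.ae_eq (hf.boundaryPreimage_ae_eq E)), ← hf.map_harmonicMeasure hz,
    Measure.map_apply₀ (hf.aemeasurable_radialLimit.mono_ac hac)]
  rw [hf.map_harmonicMeasure hz]
  exact hE.mono_ac (harmonicMeasure_absolutelyContinuous _)

lemma IsInner.muMeasure_boundaryPreimage_radius {f : ℂ → ℂ} (hf : IsInner f) {E : Set ℂ}
    (hE : NullMeasurableSet E lebCircle) {p : ℂ} (hp : p ∈ sphere (0 : ℂ) 1) {r : ℝ} (hr0 : 0 < r)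
    (hr1 : r < 1) :
    muMeasure (r * p) (boundaryPreimage f E) =
      ENNReal.ofReal ((1 - ‖f (r * p)‖ ^ 2) / (1 - r ^ 2)) * muMeasure (f (r * p)) E := by
  have hb := mul_mem_ball hr0 hr1 (mem_sphere_zero_iff_norm.1 hp).le
  have h := hf.harmonicMeasure_boundaryPreimage hE hb
  have h1 := one_sub_sq_norm_pos hb
  simp only [harmonicMeasure, Measure.smul_apply, smul_eq_mul] at h
  rw [norm_radius hp hr0] at h h1
  rw [ENNReal.ofReal_div_of_pos h1, ENNReal.div_eq_inv_mul, mul_assoc, ← h, ← mul_assoc,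
    ENNReal.inv_mul_cancel (ENNReal.ofReal_pos.2 h1).ne' ENNReal.ofReal_ne_top, one_mul]

lemma tendsto_muMeasure_radius {p : ℂ} (hp : p ∈ sphere (0 : ℂ) 1) (A : Set ℂ) :
    Tendsto (fun r : ℝ => muMeasure (r * p) A) (𝓝[<] 1) (𝓝 (muMeasure p A)) := by
  have h := tendsto_nhdsWithin_iff.1 (tendsto_radius_stolzAngle hp one_lt_two)
  exact tendsto_muMeasure h.1 zero_le_two (h.2.mono fun r hr => hr.2.le) A

end InnerFun

open InnerFun in
theorem theorem1 (f : ℂ → ℂ) (hf : InnerFun.IsInner f)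
    (p : ℂ) (hp : p ∈ Metric.sphere (0 : ℂ) 1)
    -- `p` is a boundary Fatou point of `f`, with boundary value `q = f(p)` on the unit circle
    (q : ℂ) (hq : q ∈ Metric.sphere (0 : ℂ) 1) (hpq : InnerFun.HasRadialLimit f p q)
    (E : Set ℂ) (hE : E ⊆ Metric.sphere (0 : ℂ) 1)
    (hEm : NullMeasurableSet E InnerFun.lebCircle) :
    NullMeasurableSet (InnerFun.boundaryPreimage f E) InnerFun.lebCircle ∧
    (InnerFun.absAngularDeriv f p < ∞ →
      InnerFun.muMeasure p (InnerFun.boundaryPreimage f E) =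
        InnerFun.absAngularDeriv f p * InnerFun.muMeasure q E) ∧
    (InnerFun.absAngularDeriv f p = ∞ →
      (0 < InnerFun.muMeasure q E →
        InnerFun.muMeasure p (InnerFun.boundaryPreimage f E) = ∞) ∧
      (InnerFun.muMeasure q E = 0 →
        InnerFun.muMeasure p (InnerFun.boundaryPreimage f E) = 0)) := by
  obtain ⟨c, hc0, hc, hlim⟩ := exists_tendsto_sub_div_sub hf.differentiableOn hf.mapsTo hp hq
  have hd := absAngularDeriv_eq hf.mapsTo hp hq hpq hc0 (hlim 2)
  have hleft := tendsto_muMeasure_radius hp (boundaryPreimage f E)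
  refine ⟨hf.nullMeasurableSet_boundaryPreimage hEm, fun hfin => ?_, fun hinf => ⟨fun hpos => ?_,
    fun hzero => ?_⟩⟩
  · have hcpos : 0 < c := hc0.lt_of_ne (by rintro rfl; simp [hd] at hfin)
    have hmu := tendsto_muMeasure hpq zero_le_two
      (eventually_norm_sub_le hf.mapsTo hp hq hpq hcpos (hlim 2)) E
    have hratio : Tendsto (fun r : ℝ => (1 - ‖f (r * p)‖ ^ 2) / (1 - r ^ 2)) (𝓝[<] 1)
        (𝓝 c⁻¹) := by
      have h1 := tendsto_one_sub_sq_norm_div hp hq hpq hcpos (hlim 2)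
      have h2 : Tendsto (fun r : ℝ => 1 + r) (𝓝[<] 1) (𝓝 (1 + 1)) :=
        ((continuous_const_add (1 : ℝ)).tendsto 1).mono_left nhdsWithin_le_nhds
      have h3 := h1.div h2 (by norm_num)
      rw [show 2 / c / (1 + 1) = c⁻¹ by field_simp; norm_num] at h3
      refine h3.congr fun r => ?_
      simp only [Pi.div_apply]
      rw [div_div]
      ring_nf
    rw [hd, ← ENNReal.ofReal_inv_of_pos hcpos]
    refine tendsto_nhds_unique hleft ?_
    -- μ_q(E) may be ∞; the product still converges because 1/c is neither 0 nor ∞.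
    have h := ENNReal.Tendsto.mul (ENNReal.tendsto_ofReal hratio)
      (Or.inl (ENNReal.ofReal_pos.2 (inv_pos.2 hcpos)).ne') hmu (Or.inr ENNReal.ofReal_ne_top)
    refine h.congr' ?_
    filter_upwards [eventually_pos_lt_one] with r hr
    exact (hf.muMeasure_boundaryPreimage_radius hEm hp hr.1 hr.2).symm
  · have hc00 : c = 0 := by
      rw [hd, ENNReal.inv_eq_top, ENNReal.ofReal_eq_zero] at hinf
      exact le_antisymm hinf hc0
    obtain ⟨m, hm0, hm⟩ := exists_between hpos
    have hle : ∀ n : ℕ, (n : ℝ≥0∞) * m ≤ muMeasure p (boundaryPreimage f E) := by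
      intro n
      have hratio : ∀ᶠ r : ℝ in 𝓝[<] 1, (n : ℝ) * (1 - r ^ 2) ≤ 1 - ‖f (r * p)‖ ^ 2 := by
        by_contra hcon
        -- Using n + 1 keeps the constant invertible when n = 0. Julia's lemma then makes 1/(n + 1)
        -- an admissible lower constant, against the maximality of c = 0.
        have hfreq : ∃ᶠ r : ℝ in 𝓝[<] 1, 1 - ‖f (r * p)‖ ^ 2 < (n + 1 : ℝ) * (1 - r ^ 2) := by
          refine ((not_eventually.1 hcon).and_eventually eventually_pos_lt_one).mono ?_
          rintro r ⟨h1, h2, h3⟩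
          nlinarith
        have := hc ((n + 1 : ℝ)⁻¹) fun z hz => by
          have h := julia_of_frequently hf.differentiableOn hf.mapsTo hp hpq hfreq hz
          rw [mul_assoc, inv_mul_le_iff₀ (by positivity)]
          linarith
        have h0 : (0 : ℝ) < (n + 1 : ℝ)⁻¹ := by positivity
        linarith
      refine ge_of_tendsto hleft ?_
      filter_upwards [hratio, eventually_pos_lt_one,
        eventually_lt_of_lt_liminf (hm.trans_le (muMeasure_le_liminf hpq E))] with r h1 hr h2
      rw [hf.muMeasure_boundaryPreimage_radius hEm hp hr.1 hr.2, ← ENNReal.ofReal_natCast]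
      gcongr
      rw [le_div_iff₀ (by nlinarith [hr.1, hr.2])]
      exact h1
    have htop := ENNReal.Tendsto.mul_const (b := m) ENNReal.tendsto_nat_nhds_top
      (Or.inl ENNReal.top_ne_zero)
    rw [ENNReal.top_mul hm0.ne'] at htop
    exact top_le_iff.1 (le_of_tendsto' htop hle)
  · refine muMeasure_absolutelyContinuous p ?_
    rw [← harmonicMeasure_zero, hf.harmonicMeasure_boundaryPreimage hEm (by simp)]
    exact harmonicMeasure_absolutelyContinuous _ (lebCircle_absolutelyContinuous q hzero)
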